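/- All rings are associative with unit and all morphisms are unital. For elements $x,y$ of a ring $R$ write $x\perp y$ if $xRy=yRx=0$. Let $R_q^{-1}$ be the set of quasi-invertible elements of $R$, i.e. of those $u\in R$ for which there is $v\in R$ with $(1-uv)\perp(1-vu)$. The ring $R$ is a $QB$-ring if, whenever $a,b\in R$ satisfy $Ra+Rb=R$, there is $y\in R$ with $a+yb\in R_q^{-1}$. A subring $T$ of a ring $S$ (with the same unit) is primely embedded in $S$ if any two idempotents $p,q\in T$ with $p\perp q$ in $T$ satisfy $p\perp q$ in $S$; it is quasi-primely embedded in $S$ if $T_q^{-1}\subseteq S_q^{-1}$. **Theorem.** Let $\alpha:A\to C$, $\beta:B\to C$, $\gamma:R\to B$, $\delta:R\to A$ be ring homomorphisms with $\alpha\delta=\beta\gamma$ and $\alpha$ surjective, such that the square is a pullback, i.e. $r\mapsto(\delta(r),\gamma(r))$ is an isomorphism of $R$ onto $A\oplus_C B=\{(a,b)\in A\oplus B : \alpha(a)=\beta(b)\}$. (Then $\gamma$ is surjective and $\delta$ maps $I=\ker\gamma$ isomorphically onto $\ker\alpha$.) Assume that $A$ and $B$ are $QB$-rings. 1. If $\beta(B)$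 is primely embedded in $C$, then $R$ is a $QB$-ring and $\delta(R)$ is primely embedded in $A$. 2. If $\beta(B)$ is quasi-primely embedded in $C$, then $R$ is a $QB$-ring and $\delta(R)$ is quasi-primely embedded in $A$. -/

import Mathlib

/-- Elements `x`, `y` of a ring are centrally orthogonal, `x ⊥ y`, if `xRy = yRx = 0`. -/
def CentrallyOrthogonal {R : Type*} [Ring R] (x y : R) : Prop :=
  (∀ r : R, x * r * y = 0) ∧ (∀ r : R, y * r * x = 0)

/-- `u` is quasi-invertible, `u ∈ R_q⁻¹`, if `(1 - uv) ⊥ (1 - vu)` for some `v` in `R`. -/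
def IsQuasiInvertible {R : Type*} [Ring R] (u : R) : Prop :=
  ∃ v : R, CentrallyOrthogonal (1 - u * v) (1 - v * u)

/-- A unital ring `R` is a QB-ring if `Ra + Rb = R` implies `a + yb ∈ R_q⁻¹` for some `y`.
Over a noncommutative ring, `Ideal` means left ideal, so `Ideal.span {a} = Ra`. -/
def IsQBRing (R : Type*) [Ring R] : Prop :=
  ∀ a b : R, Ideal.span {a} ⊔ Ideal.span {b} = (⊤ : Ideal R) →
    ∃ y : R, IsQuasiInvertible (a + y * b)

/-- A (unital) subring `T` of `S` is primely embedded if idempotents of `T` that are centrally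
orthogonal in the ring `T` are centrally orthogonal in `S`. -/
def IsPrimelyEmbedded {S : Type*} [Ring S] (T : Subring S) : Prop :=
  ∀ p q : T, IsIdempotentElem p → IsIdempotentElem q →
    CentrallyOrthogonal p q → CentrallyOrthogonal (p : S) (q : S)

/-- A (unital) subring `T` of `S` is quasi-primely embedded if `T_q⁻¹ ⊆ S_q⁻¹`. -/
def IsQuasiPrimelyEmbedded {S : Type*} [Ring S] (T : Subring S) : Prop :=
  ∀ u : T, IsQuasiInvertible u → IsQuasiInvertible (u : S)

/-- The commutative square with `γ : R → B`, `δ : R → A`, `α : A → C`, `β : B → C` is a surjective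
pullback diagram: `r ↦ (δ r, γ r)` is a bijection of `R` onto
`A ⊕_C B = {(a, b) | α a = β b}`, and `α` is surjective. Then `γ` is surjective and `δ` restricts
to an isomorphism of `ker γ` onto `ker α`, the common kernel of the two rows. -/
structure IsSurjectivePullback {R A B C : Type*} [Ring R] [Ring A] [Ring B] [Ring C]
    (γ : R →+* B) (δ : R →+* A) (α : A →+* C) (β : B →+* C) : Prop where
  comm : α.comp δ = β.comp γ
  existsUnique_lift : ∀ (a : A) (b : B), α a = β b → ∃! r : R, δ r = a ∧ γ r = b
  surjective : Function.Surjective α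

/-! Any inner inverse of a quasi-invertible element is a quasi-inverse, and inner inverses lift
along `α`; so an element of `R` with quasi-invertible components in `A` and `B` is quasi-invertible.
For the `QB` property, first make the `B`-component quasi-invertible. The hypothesis on `β` makes
its image in `C` quasi-invertible, so the `A`-component can be corrected modulo `ker α`, and the
correction lifts to `ker γ`. The embedding claims hold because `α p ⊥ α q` puts `p * x * q` in `ker
α`, inside `δ.range`, where `p ⊥ q` already holds. -/

theorem CentrallyOrthogonal.map {R S : Type*} [Ring R] [Ring S] {x y : R}
    (h : CentrallyOrthogonal x y) (f : R →+* S) (hf : Function.Surjective f) :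
    CentrallyOrthogonal (f x) (f y) := by
  constructor <;> intro s <;> obtain ⟨r, rfl⟩ := hf s <;> rw [← map_mul, ← map_mul]
  · rw [h.1, map_zero]
  · rw [h.2, map_zero]

theorem CentrallyOrthogonal.mul {R : Type*} [Ring R] {x y : R}
    (h : CentrallyOrthogonal x y) (s t s' t' : R) :
    CentrallyOrthogonal (s * x * t) (s' * y * t') := by
  constructor <;> intro r
  · calc s * x * t * r * (s' * y * t') = s * (x * (t * r * s') * y) * t' := by noncomm_ring
      _ = 0 := by simp [h.1]
  · calc s' * y * t' * r * (s * x * t) = s' * (y * (t' * r * s) * x) * t := by noncomm_ring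
      _ = 0 := by simp [h.2]

/-! ### Quasi-inverses and inner inverses -/

/-- A quasi-invertible element has a reflexive generalized inverse. -/
theorem IsQuasiInvertible.exists_reflexive {R : Type*} [Ring R] {u : R}
    (h : IsQuasiInvertible u) :
    ∃ v : R, u * v * u = u ∧ v * u * v = v ∧ CentrallyOrthogonal (1 - u * v) (1 - v * u) := by
  obtain ⟨v, hv⟩ := h
  have hu := hv.1 u
  -- Chosen to square both defects `1 - u * v` and `1 - v * u`.
  obtain ⟨x, hx⟩ : ∃ x, x = 2 * v - v * u * v := ⟨_, rfl⟩
  have h1 : 1 - u * x = (1 - u * v) * (1 - u * v) := by rw [hx]; noncomm_ring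
  have h2 : 1 - x * u = (1 - v * u) * (1 - v * u) := by rw [hx]; noncomm_ring
  have hux : u * x * u = u := by
    have : u - u * x * u = (1 - u * v) * u * (1 - v * u) := by rw [hx]; noncomm_ring
    rw [hu] at this
    exact (sub_eq_zero.1 this).symm
  have e1 : u * (x * u * x) = u * x := by
    rw [← mul_assoc, ← mul_assoc, hux]
  have e2 : x * u * x * u = x * u := by
    rw [mul_assoc (x * u), mul_assoc x, ← mul_assoc u, hux]
  refine ⟨x * u * x, by rw [e1, hux], by rw [e2, ← mul_assoc, ← mul_assoc, e2], ?_⟩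
  rw [e1, e2, h1, h2]
  simpa using hv.mul 1 (1 - u * v) 1 (1 - v * u)

/-- Every inner inverse of a quasi-invertible element is a quasi-inverse. -/
theorem IsQuasiInvertible.centrallyOrthogonal {R : Type*} [Ring R] {u x : R}
    (h : IsQuasiInvertible u) (hx : u * x * u = u) :
    CentrallyOrthogonal (1 - u * x) (1 - x * u) := by
  obtain ⟨v, hv⟩ := h
  have h1 : (1 - u * x) * (1 - u * v) * 1 = 1 - u * x := by
    calc _ = 1 - u * x - (u - u * x * u) * v := by noncomm_ring
      _ = _ := by rw [hx]; simp
  have h2 : 1 * (1 - v * u) * (1 - x * u) = 1 - x * u := by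
    calc _ = 1 - x * u - v * (u - u * x * u) := by noncomm_ring
      _ = _ := by rw [hx]; simp
  rw [← h1, ← h2]
  exact hv.mul _ _ _ _

theorem IsQuasiInvertible.map {R S : Type*} [Ring R] [Ring S] {u : R}
    (h : IsQuasiInvertible u) (f : R →+* S) (hf : Function.Surjective f) :
    IsQuasiInvertible (f u) := by
  obtain ⟨v, hv⟩ := h
  exact ⟨f v, by simpa using hv.map f hf⟩

/-- Quasi-invertibility is preserved by multiplication by a unipotent `1 + n`, `n ^ 2 = 0`. -/
theorem IsQuasiInvertible.mul_one_add {R : Type*} [Ring R] {u n : R}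
    (h : IsQuasiInvertible u) (hn : n * n = 0) : IsQuasiInvertible (u * (1 + n)) := by
  obtain ⟨v, hv⟩ := h
  refine ⟨(1 - n) * v, ?_⟩
  have h1 : 1 - u * (1 + n) * ((1 - n) * v) = 1 * (1 - u * v) * 1 := by
    calc _ = 1 * (1 - u * v) * 1 + u * (n * n) * v := by noncomm_ring
      _ = _ := by rw [hn]; simp
  have h2 : 1 - (1 - n) * v * (u * (1 + n)) = (1 - n) * (1 - v * u) * (1 + n) := by
    calc _ = (1 - n) * (1 - v * u) * (1 + n) + n * n := by noncomm_ring
      _ = _ := by rw [hn]; simp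
  rw [h1, h2]
  exact hv.mul _ _ _ _

/-- Inner inverses lift along surjections, for an element that already has an inner inverse. -/
theorem exists_inner_inverse_lift {A C : Type*} [Ring A] [Ring C] (α : A →+* C)
    (hα : Function.Surjective α) {w v : A} (hv : w * v * w = w) {d : C}
    (hd : α w * d * α w = α w) : ∃ x : A, w * x * w = w ∧ α x = d := by
  obtain ⟨t, ht⟩ := hα (d - α v)
  -- The last term cancels `w * t * w`; it vanishes in `C` because `d` and `α v` are both inner
  -- inverses of `α w`.
  refine ⟨v + t - v * w * t * w * v, ?_, ?_⟩
  · calc _ = w * v * w + w * t * w - (w * v * w) * t * (w * v * w) := by noncomm_ring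
      _ = w := by rw [hv]; abel
  · have hv' : α w * α v * α w = α w := by rw [← map_mul, ← map_mul, hv]
    have h0 : α w * (d - α v) * α w = 0 := by rw [mul_sub, sub_mul, hd, hv', sub_self]
    rw [map_sub, map_add]
    simp only [map_mul, ht]
    calc _ = d - α v * (α w * (d - α v) * α w) * α v := by noncomm_ring
      _ = d := by rw [h0]; simp

/-! ### Perturbation without change of image -/

/-- In a `QB`-ring, an element whose image in a quotient is quasi-invertible can be perturbed to a
quasi-invertible element without changing that image, by a left multiple of `1 - V * a`. -/
theorem IsQBRing.exists_quasiInvertible_same_image {A C : Type*} [Ring A] [Ring C]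
    (hA : IsQBRing A) (α : A →+* C) (hα : Function.Surjective α) (a V : A)
    (h1 : α a * α V * α a = α a) (h2 : α V * α a * α V = α V)
    (h3 : CentrallyOrthogonal (1 - α a * α V) (1 - α V * α a)) :
    ∃ y : A, IsQuasiInvertible (a + y * (1 - V * a)) ∧ α (y * (1 - V * a)) = 0 := by
  obtain ⟨y₀, hw⟩ := hA a (1 - V * a) (by
    rw [Ideal.eq_top_iff_one]
    exact Submodule.mem_sup.2 ⟨V * a, Ideal.mul_mem_left _ _ (Ideal.mem_span_singleton_self _),
      1 - V * a, Ideal.mem_span_singleton_self _, add_sub_cancel _ _⟩)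
  obtain ⟨w, hw_def⟩ : ∃ w, w = a + y₀ * (1 - V * a) := ⟨_, rfl⟩
  rw [← hw_def] at hw
  set c := α a
  set d := α V
  -- The image of `w` is off by a unipotent: `α w = c * (1 + e)` with `e * e = 0`. Right
  -- multiplication of `w` by a lift of `1 - e` repairs it.
  obtain ⟨e, he⟩ : ∃ e, e = d * α y₀ * (1 - d * c) := ⟨_, rfl⟩
  have hαw : α w = c + c * e := by
    have h0 := h3.1 (α y₀)
    have : α w = c + α y₀ * (1 - d * c) := by simp [hw_def, c, d]
    rw [this, he]
    calc _ = c + c * (d * α y₀ * (1 - d * c)) + (1 - c * d) * α y₀ * (1 - d * c) := by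
          noncomm_ring
      _ = _ := by rw [h0, add_zero]
  have hed : e * d = 0 := by
    calc e * d = d * α y₀ * (d - d * c * d) := by rw [he]; noncomm_ring
      _ = 0 := by rw [h2]; simp
  have hdce : d * c * e = e := by
    calc d * c * e = (d * c * d) * α y₀ * (1 - d * c) := by rw [he]; noncomm_ring
      _ = e := by rw [h2, he]
  have hee : e * e = 0 := by
    nth_rw 2 [← hdce]
    rw [mul_assoc d, ← mul_assoc, hed, zero_mul]
  have hdw : d * α w = d * c + e := by rw [hαw, mul_add, ← mul_assoc, hdce]
  have hdwd : d * α w * d = d := by rw [hdw, add_mul, h2, hed, add_zero]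
  have hwdw : α w * d * α w = α w := by
    rw [mul_assoc, hdw, hαw]
    calc _ = c * d * c + c * e + c * (e * d) * c + c * (e * e) := by noncomm_ring
      _ = _ := by rw [h1, hed, hee]; simp
  obtain ⟨v₀, hv₀, -, -⟩ := hw.exists_reflexive
  obtain ⟨v, hv, hαv⟩ := exists_inner_inverse_lift α hα hv₀ hwdw
  -- An idempotent in `A * (1 - V * a)` killed by `w`: it keeps the correction a left multiple of `1
  -- - V * a`, and `(1 - f) * z * f` is a square-zero lift of `-e` when `α z = -e`.
  obtain ⟨f, hf⟩ : ∃ f, f = (1 - v * w) * (1 - V * w) := ⟨_, rfl⟩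
  have hwf : w * f = 0 := by
    calc w * f = (w - w * v * w) * (1 - V * w) := by rw [hf]; noncomm_ring
      _ = 0 := by rw [hv]; simp
  have hff : f * f = f := by
    calc f * f = (1 - v * w) * f - (1 - v * w) * V * (w * f) := by rw [hf]; noncomm_ring
      _ = f - v * (w * f) := by rw [hwf, mul_zero, sub_zero, sub_mul, one_mul, mul_assoc, hwf]
      _ = f := by rw [hwf]; simp
  have hft : f = (1 - v * w) * (1 - V * y₀) * (1 - V * a) := by
    have : 1 - V * w = (1 - V * y₀) * (1 - V * a) := by rw [hw_def]; noncomm_ring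
    rw [hf, this, mul_assoc]
  have hαf : α f = 1 - d * c - e := by
    have : α f = (1 - d * α w) * (1 - d * α w) := by
      simp [hf, hαv, d]
    rw [this]
    calc _ = 1 - d * α w - d * α w + (d * α w * d) * α w := by noncomm_ring
      _ = _ := by rw [hdwd, hdw]; abel
  obtain ⟨z, hz⟩ := hα (-e)
  have hn : ((1 - f) * z * f) * ((1 - f) * z * f) = 0 := by
    calc _ = (1 - f) * z * (f - f * f) * z * f := by noncomm_ring
      _ = 0 := by rw [hff]; simp
  have key : a + (y₀ + w * z * ((1 - v * w) * (1 - V * y₀))) * (1 - V * a)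
      = w * (1 + (1 - f) * z * f) := by
    calc _ = (a + y₀ * (1 - V * a)) + w * z * ((1 - v * w) * (1 - V * y₀) * (1 - V * a)) := by
          noncomm_ring
      _ = w + w * z * f - (w * f) * z * f := by rw [← hft, ← hw_def, hwf]; simp
      _ = _ := by noncomm_ring
  refine ⟨y₀ + w * z * ((1 - v * w) * (1 - V * y₀)), ?_, ?_⟩
  · rw [key]
    exact hw.mul_one_add hn
  · rw [← add_sub_cancel_left a (_ * _), key, map_sub]
    have : w * (1 + (1 - f) * z * f) = w + w * z * f - (w * f) * z * f := by noncomm_ring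
    rw [this, hwf, zero_mul, zero_mul, sub_zero, map_add, map_mul, map_mul, hz, hαf, hαw]
    change _ - c = 0
    have hedc : e * (d * c) = 0 := by rw [← mul_assoc, hed, zero_mul]
    calc _ = c * (e * (d * c)) + c * (e * e) - c * (e * e) + c * (e * e) * (d * c)
          + c * (e * e) * e := by noncomm_ring
      _ = 0 := by rw [hedc, hee]; simp

/-! ### Surjective pullbacks -/

section Pullback

variable {R A B C : Type*} [Ring R] [Ring A] [Ring B] [Ring C]
  {γ : R →+* B} {δ : R →+* A} {α : A →+* C} {β : B →+* C}

namespace IsSurjectivePullback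

theorem comm_apply (h : IsSurjectivePullback γ δ α β) (r : R) : α (δ r) = β (γ r) :=
  RingHom.congr_fun h.comm r

theorem ext (h : IsSurjectivePullback γ δ α β) {r s : R} (h1 : δ r = δ s) (h2 : γ r = γ s) :
    r = s :=
  (h.existsUnique_lift (δ s) (γ s) (h.comm_apply s)).unique ⟨h1, h2⟩ ⟨rfl, rfl⟩

theorem surjective_right (h : IsSurjectivePullback γ δ α β) : Function.Surjective γ := by
  intro b
  obtain ⟨a, ha⟩ := h.surjective (β b)
  obtain ⟨r, hr, -⟩ := h.existsUnique_lift a b ha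
  exact ⟨r, hr.2⟩

theorem mem_range_of_map_eq_zero (h : IsSurjectivePullback γ δ α β) {a : A} (ha : α a = 0) :
    a ∈ δ.range := by
  obtain ⟨r, hr, -⟩ := h.existsUnique_lift a 0 (by rw [ha, map_zero])
  exact ⟨r, hr.1⟩

/-- The restriction of `α` to the image of the pullback. -/
def rangeMap (h : IsSurjectivePullback γ δ α β) : δ.range →+* β.range :=
  α.restrict δ.range β.range (by
    rintro _ ⟨r, rfl⟩
    exact ⟨γ r, (h.comm_apply r).symm⟩)

theorem rangeMap_surjective (h : IsSurjectivePullback γ δ α β) :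
    Function.Surjective h.rangeMap := by
  rintro ⟨_, b, rfl⟩
  obtain ⟨r, rfl⟩ := h.surjective_right b
  exact ⟨⟨δ r, r, rfl⟩, Subtype.ext (h.comm_apply r)⟩

theorem centrallyOrthogonal (h : IsSurjectivePullback γ δ α β) {r s : R}
    (hA : CentrallyOrthogonal (δ r) (δ s)) (hB : CentrallyOrthogonal (γ r) (γ s)) :
    CentrallyOrthogonal r s := by
  constructor <;> intro t <;> apply h.ext <;> simp [hA.1, hA.2, hB.1, hB.2]

/-- An element of a surjective pullback is quasi-invertible if both of its components are. -/
theorem isQuasiInvertible (h : IsSurjectivePullback γ δ α β) {r : R}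
    (hA : IsQuasiInvertible (δ r)) (hB : IsQuasiInvertible (γ r)) : IsQuasiInvertible r := by
  obtain ⟨v, hv, -, -⟩ := hA.exists_reflexive
  obtain ⟨x, hx, -, -⟩ := hB.exists_reflexive
  -- The two inverses may disagree in `C`; the one in `A` is adjusted to match.
  obtain ⟨v', hv', hαv'⟩ := exists_inner_inverse_lift α h.surjective hv (d := β x) (by
    rw [h.comm_apply, ← map_mul, ← map_mul, hx])
  obtain ⟨s, ⟨hs1, hs2⟩, -⟩ := h.existsUnique_lift v' x hαv'
  refine ⟨s, h.centrallyOrthogonal ?_ ?_⟩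
  · simpa [hs1] using hA.centrallyOrthogonal hv'
  · simpa [hs2] using hB.centrallyOrthogonal hx

/-- Idempotents of the image of the pullback are centrally orthogonal in `A` as soon as they are so
in the image and modulo the kernel of `α`, which lies in the image. -/
theorem centrallyOrthogonal_coe (h : IsSurjectivePullback γ δ α β) {p q : δ.range}
    (hp : IsIdempotentElem p) (hq : IsIdempotentElem q) (hpq : CentrallyOrthogonal p q)
    (hC : CentrallyOrthogonal (α p) (α q)) : CentrallyOrthogonal (p : A) (q : A) := by
  have hp' : (p : A) * p = p := congrArg Subtype.val hp.eq
  have hq' : (q : A) * q = q := congrArg Subtype.val hq.eq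
  constructor <;> intro x
  · have hx : α (p * x * q) = 0 := by simp [hC.1]
    have := congrArg Subtype.val (hpq.1 ⟨_, h.mem_range_of_map_eq_zero hx⟩)
    calc (p : A) * x * q = (p * p) * x * (q * q) := by rw [hp', hq']
      _ = p * (p * x * q) * q := by noncomm_ring
      _ = 0 := this
  · have hx : α (q * x * p) = 0 := by simp [hC.2]
    have := congrArg Subtype.val (hpq.2 ⟨_, h.mem_range_of_map_eq_zero hx⟩)
    calc (q : A) * x * p = (q * q) * x * (p * p) := by rw [hp', hq']
      _ = q * (q * x * p) * p := by noncomm_ring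
      _ = 0 := this

theorem isPrimelyEmbedded (h : IsSurjectivePullback γ δ α β)
    (hβ : IsPrimelyEmbedded β.range) : IsPrimelyEmbedded δ.range := fun _ _ hp hq hpq =>
  h.centrallyOrthogonal_coe hp hq hpq
    (hβ _ _ (hp.map h.rangeMap) (hq.map h.rangeMap) (hpq.map _ h.rangeMap_surjective))

theorem isQuasiPrimelyEmbedded (h : IsSurjectivePullback γ δ α β)
    (hβ : IsQuasiPrimelyEmbedded β.range) : IsQuasiPrimelyEmbedded δ.range := by
  intro u hu
  have hC : IsQuasiInvertible (α u) := hβ _ (hu.map _ h.rangeMap_surjective)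
  obtain ⟨v, huvu, hvuv, huv⟩ := hu.exists_reflexive
  have huvu' : α u * α v * α u = α u := by
    rw [← map_mul, ← map_mul]
    exact congrArg α (congrArg Subtype.val huvu)
  have hp : IsIdempotentElem (u * v) := by
    rw [IsIdempotentElem, ← mul_assoc, huvu]
  have hq : IsIdempotentElem (v * u) := by
    rw [IsIdempotentElem, ← mul_assoc, hvuv]
  refine ⟨v, h.centrallyOrthogonal_coe hp.one_sub hq.one_sub huv ?_⟩
  simpa using hC.centrallyOrthogonal huvu'

theorem isQBRing (h : IsSurjectivePullback γ δ α β) (hA : IsQBRing A) (hB : IsQBRing B)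
    (hβ : IsQuasiPrimelyEmbedded β.range) : IsQBRing R := by
  intro r₀ s hrs
  have hrs' : Ideal.span {γ r₀} ⊔ Ideal.span {γ s} = (⊤ : Ideal B) := by
    have := congrArg (Ideal.map γ) hrs
    rwa [Ideal.map_sup, Ideal.map_span, Ideal.map_span, Set.image_singleton, Set.image_singleton,
      Ideal.map_top] at this
  obtain ⟨b, hb⟩ := hB _ _ hrs'
  obtain ⟨y₁, rfl⟩ := h.surjective_right b
  obtain ⟨r, hr⟩ : ∃ r, r = r₀ + y₁ * s := ⟨_, rfl⟩
  have hγr : IsQuasiInvertible (γ r) := by simpa [hr] using hb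
  obtain ⟨x₀, x', hx₀⟩ : ∃ x x', x * r₀ + x' * s = 1 := by
    have : (1 : R) ∈ Ideal.span {r₀} ⊔ Ideal.span {s} := hrs ▸ Submodule.mem_top
    obtain ⟨p, hp, q, hq, hpq⟩ := Submodule.mem_sup.1 this
    obtain ⟨x, rfl⟩ := Ideal.mem_span_singleton'.1 hp
    obtain ⟨x', rfl⟩ := Ideal.mem_span_singleton'.1 hq
    exact ⟨x, x', hpq⟩
  have hx : x₀ * r + (x' - x₀ * y₁) * s = 1 := by
    rw [← hx₀, hr]; noncomm_ring
  generalize x' - x₀ * y₁ = x₁ at hx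
  obtain ⟨v, hv, -, -⟩ := hγr.exists_reflexive
  obtain ⟨V₀, rfl⟩ := h.surjective_right v
  -- The added term forces `1 - V₁ * r` into `R * s`; under `γ`, left multiplication by `r` kills
  -- it.
  obtain ⟨V₁, hV₁⟩ : ∃ V, V = V₀ + (1 - V₀ * r) * x₀ := ⟨_, rfl⟩
  have ht₁ : 1 - V₁ * r = (1 - V₀ * r) * x₁ * s := by
    calc 1 - V₁ * r = (1 - V₀ * r) * (1 - x₀ * r) := by rw [hV₁]; noncomm_ring
      _ = _ := by rw [← hx]; noncomm_ring
  have hV₁' : γ r * γ V₁ * γ r = γ r := by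
    calc _ = γ r * γ V₀ * γ r + (γ r - γ r * γ V₀ * γ r) * γ x₀ * γ r := by
          simp only [hV₁, map_add, map_mul, map_sub, map_one]; noncomm_ring
      _ = γ r := by rw [hv]; simp
  -- `V` is a lift of a reflexive inverse of `γ r`, and `1 - V * r` lies in `R * s`.
  obtain ⟨V, hV⟩ : ∃ V, V = V₁ * r * V₁ := ⟨_, rfl⟩
  obtain ⟨g, hg⟩ : ∃ g, 1 - V * r = g * s := by
    refine ⟨(1 + V₁ * r) * ((1 - V₀ * r) * x₁), ?_⟩
    rw [mul_assoc, ← ht₁, hV]; noncomm_ring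
  have hγV : γ V = γ V₁ * γ r * γ V₁ := by simp [hV]
  have hrV : γ r * γ V = γ r * γ V₁ := by rw [hγV, ← mul_assoc, ← mul_assoc, hV₁']
  have hVr : γ V * γ r = γ V₁ * γ r := by
    rw [hγV, mul_assoc (γ V₁ * γ r), mul_assoc (γ V₁), ← mul_assoc (γ r), hV₁']
  have k1 : γ r * γ V * γ r = γ r := by rw [hrV, hV₁']
  have k2 : γ V * γ r * γ V = γ V := by
    rw [hVr, mul_assoc, hrV, ← mul_assoc, ← hγV]
  -- Squaring `1 - V * r` leaves its image in `B` unchanged.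
  obtain ⟨W, hW⟩ : ∃ W, W = V + V - V * r * V := ⟨_, rfl⟩
  have hWt : 1 - W * r = (1 - V * r) * (1 - V * r) := by rw [hW]; noncomm_ring
  have hγW : γ W = γ V := by
    calc γ W = γ V + γ V - γ V * γ r * γ V := by simp [hW]
      _ = γ V := by rw [k2]; abel
  have hCr : IsQuasiInvertible (β (γ r)) :=
    hβ _ (hγr.map β.rangeRestrict β.rangeRestrict_surjective)
  have c1 : β (γ r) * β (γ V) * β (γ r) = β (γ r) := by rw [← map_mul, ← map_mul, k1]
  have c2 : β (γ V) * β (γ r) * β (γ V) = β (γ V) := by rw [← map_mul, ← map_mul, k2]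
  obtain ⟨y, hy, hαy⟩ := hA.exists_quasiInvertible_same_image α h.surjective (δ r) (δ W)
    (by simpa [h.comm_apply, hγW] using c1) (by simpa [h.comm_apply, hγW] using c2)
    (by simpa [h.comm_apply, hγW] using hCr.centrallyOrthogonal c1)
  -- One factor `1 - V * r` is absorbed into `k` in `ker γ`; the other is `g * s`, so the correction
  -- stays in `R * s`.
  have hδ : 1 - δ W * δ r = δ (1 - V * r) * δ (1 - V * r) := by
    rw [← map_mul δ (1 - V * r), ← hWt]; simp
  have hα : α (y * δ (1 - V * r)) = 0 := by
    have : α (δ (1 - V * r)) = α (1 - δ W * δ r) := by simp [h.comm_apply, hγW]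
    rw [map_mul, this, ← map_mul, hαy]
  obtain ⟨k, ⟨hk1, hk2⟩, -⟩ := h.existsUnique_lift (y * δ (1 - V * r)) 0 (by rw [hα, map_zero])
  refine ⟨y₁ + k * g, ?_⟩
  have : r₀ + (y₁ + k * g) * s = r + k * (1 - V * r) := by rw [hg, hr]; noncomm_ring
  rw [this]
  apply h.isQuasiInvertible
  · rwa [map_add, map_mul, hk1, mul_assoc, ← hδ]
  · rwa [map_add, map_mul, hk2, zero_mul, add_zero]

end IsSurjectivePullback

end Pullback

/-- For a reflexive inverse `v`, both `1 - u * v` and `1 - v * u` are idempotents. -/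
theorem IsPrimelyEmbedded.isQuasiPrimelyEmbedded {S : Type*} [Ring S] {T : Subring S}
    (hT : IsPrimelyEmbedded T) : IsQuasiPrimelyEmbedded T := by
  intro u hu
  obtain ⟨v, huvu, hvuv, huv⟩ := hu.exists_reflexive
  have hp : IsIdempotentElem (u * v) := by
    rw [IsIdempotentElem, ← mul_assoc, huvu]
  have hq : IsIdempotentElem (v * u) := by
    rw [IsIdempotentElem, ← mul_assoc, hvuv]
  exact ⟨v, hT _ _ hp.one_sub hq.one_sub huv⟩

theorem theorem2p3 {R A B C : Type*} [Ring R] [Ring A] [Ring B] [Ring C]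
    (γ : R →+* B) (δ : R →+* A) (α : A →+* C) (β : B →+* C)
    (h : IsSurjectivePullback γ δ α β) (hA : IsQBRing A) (hB : IsQBRing B) :
    (IsPrimelyEmbedded β.range → IsQBRing R ∧ IsPrimelyEmbedded δ.range) ∧
    (IsQuasiPrimelyEmbedded β.range → IsQBRing R ∧ IsQuasiPrimelyEmbedded δ.range) :=
  ⟨fun hβ => ⟨h.isQBRing hA hB hβ.isQuasiPrimelyEmbedded, h.isPrimelyEmbedded hβ⟩,
    fun hβ => ⟨h.isQBRing hA hB hβ, h.isQuasiPrimelyEmbedded hβ⟩⟩
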